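/- All topological groups are Hausdorff. A topological group $G$ is called $c$-compact if for every topological group $H$ the projection $G\times H\to H$ maps closed subgroups of $G\times H$ onto closed subgroups of $H$. Every $c$-compact group $G$ has a maximal compact quotient $G/M$, where $M$ is a closed characteristic subgroup of $G$ that is minimally almost periodic. That is, there is a closed normal subgroup $M$ of $G$ such that 1. $G/M$ is compact, and $M\subseteq N$ for every closed normal subgroup $N$ of $G$ with $G/N$ compact; 2. $\varphi(M)=M$ for every automorphism $\varphi$ of the topological group $G$ (every group automorphism that is a homeomorphism); 3. $M$, with the subspace topology, has no nontrivial finite-dimensional unitary representations: every continuous homomorphism $M\to U(n)$, $n\ge 0$, is trivial. -/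

import Mathlib

/-- A topological group `G` is *c-compact* if for every Hausdorff topological group `H`, the
projection `G × H → H` maps closed subgroups of `G × H` onto closed subgroups of `H`. -/
def IsCCompact.{u} (G : Type u) [Group G] [TopologicalSpace G] : Prop :=
  ∀ (H : Type u) [Group H] [TopologicalSpace H] [IsTopologicalGroup H] [T2Space H]
    (S : Subgroup (G × H)), IsClosed (S : Set (G × H)) →
      IsClosed ((S.map (MonoidHom.snd G H) : Subgroup H) : Set H)

/-- A topological group is *minimally almost periodic* if it has no nontrivial finite-dimensional
unitary representations: every continuous homomorphism to a group `U(n)` is trivial. -/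
def IsMinimallyAlmostPeriodic (G : Type*) [Group G] [TopologicalSpace G] : Prop :=
  ∀ (n : ℕ) (ρ : G →* Matrix.unitaryGroup (Fin n) ℂ), Continuous ρ → ∀ g : G, ρ g = 1

/-- A subgroup of a topological group `G` is *characteristic* (in the sense of topological groups)
if it is mapped onto itself by every automorphism of the topological group `G`. -/
def IsTopologicallyCharacteristic {G : Type*} [Group G] [TopologicalSpace G]
    (M : Subgroup G) : Prop :=
  ∀ φ : G ≃ₜ* G, M.map (φ : G ≃* G).toMonoidHom = M

/-- `G ⧸ M` is the *maximal compact quotient* of `G`: it is a compact Hausdorff quotient group of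
`G`, and every compact Hausdorff quotient group `G ⧸ N` of `G` is a further quotient of it. -/
structure IsMaximalCompactQuotient {G : Type*} [Group G] [TopologicalSpace G]
    (M : Subgroup G) : Prop where
  normal : M.Normal
  isClosed : IsClosed (M : Set G)
  compact : CompactSpace (G ⧸ M)
  maximal : ∀ N : Subgroup G, N.Normal → IsClosed (N : Set G) → CompactSpace (G ⧸ N) → M ≤ N

open Topology Filter Set

/-! The crux is `compactSpace_of_injective`: a c-compact group `G` with a continuous injective
homomorphism into a compact Hausdorff group is compact. Hence `G ⧸ f.ker` is compact for every
continuous `f` into such a group. Taking for `f` the map into the product of all compact Hausdorff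
quotients gives `M = f.ker`; it lies in the kernel of every continuous homomorphism to a compact
Hausdorff group, so it is characteristic. The subgroup `M` is again c-compact and has its own such
`L`, which is normal in `G`. Since `G ⧸ M` and `M ⧸ L` are compact, so is `G ⧸ L`, whence `M = L`
and unitary representations of `M` are trivial.

The crux rests on an open mapping theorem. For `ω`-narrow `G`, Baire category makes a surjection
onto a compact group almost open, and c-compactness replaces completeness: mapping `G` into a group
of sequences times `K` forces suitable Cauchy sequences to converge in `G`. The general case reduces
to closures of countable subgroups. -/

namespace IsCCompact

-- Closed images, quotients and subgroups of c-compact groups.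

universe u

variable {G : Type u} [Group G] [TopologicalSpace G]

/-- The image of a `c`-compact group under a continuous homomorphism is closed, up to
inseparability, in every topological group. -/
theorem exists_inseparable (hG : IsCCompact G) {H : Type u} [Group H] [TopologicalSpace H]
    [IsTopologicalGroup H] (φ : G →* H) (hφ : Continuous φ) {x : H} (hx : x ∈ closure (range φ)) :
    ∃ g, Inseparable (φ g) x := by
  let ψ : G →* SeparationQuotient H := SeparationQuotient.mkMonoidHom.comp φ
  have hψ : Continuous ψ := SeparationQuotient.continuous_mk.comp hφ
  -- The separation quotient is Hausdorff, so the graph is closed; its projection is the range.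
  have hS : IsClosed (ψ.graph : Set (G × SeparationQuotient H)) :=
    isClosed_eq (hψ.comp continuous_fst) continuous_snd
  have hr := hG (SeparationQuotient H) ψ.graph hS
  have hsnd : ((ψ.graph.map (MonoidHom.snd G (SeparationQuotient H)) :
      Subgroup (SeparationQuotient H)) : Set (SeparationQuotient H)) = range ψ := by
    ext y
    simp
  rw [hsnd] at hr
  have hmem : SeparationQuotient.mk x ∈ closure (range ψ) := by
    have := image_closure_subset_closure_image SeparationQuotient.continuous_mk
      (mem_image_of_mem SeparationQuotient.mk hx)
    rwa [← range_comp] at this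
  rw [hr.closure_eq] at hmem
  obtain ⟨g, hg⟩ := hmem
  exact ⟨g, SeparationQuotient.mk_eq_mk.1 hg⟩

theorem isClosed_range (hG : IsCCompact G) {H : Type u} [Group H] [TopologicalSpace H]
    [IsTopologicalGroup H] [T2Space H] (φ : G →* H) (hφ : Continuous φ) : IsClosed (range φ) := by
  refine isClosed_of_closure_subset fun x hx => ?_
  obtain ⟨g, hg⟩ := hG.exists_inseparable φ hφ hx
  exact ⟨g, hg.eq⟩

theorem of_surjective (hG : IsCCompact G) {G' : Type u} [Group G'] [TopologicalSpace G']
    (ψ : G →* G') (hψ : Continuous ψ) (hs : Function.Surjective ψ) : IsCCompact G' := by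
  intro H _ _ _ _ S hS
  have := hG H (S.comap (ψ.prodMap (MonoidHom.id H)))
    (hS.preimage ((hψ.comp continuous_fst).prodMk continuous_snd))
  convert this using 1
  ext y
  simp [hs.exists]

theorem subgroup (hG : IsCCompact G) (M : Subgroup G) (hM : IsClosed (M : Set G)) :
    IsCCompact M := by
  intro H _ _ _ _ S hS
  have he : IsClosedEmbedding (Prod.map M.subtype (id : H → H)) :=
    hM.isClosedEmbedding_subtypeVal.prodMap .id
  have := hG H (S.map (M.subtype.prodMap (MonoidHom.id H))) (he.isClosedMap _ hS)
  convert this using 1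
  ext y
  simp

end IsCCompact

/-! ### Sequence groups and two-sided Cauchy sequences. -/

/-- A decreasing sequence of symmetric subsets of a group `G` which is a base at `1` of a group
topology on `G` (Hausdorff or not). -/
structure IsNhdsOneSeq {G : Type*} [Group G] (U : ℕ → Set G) : Prop where
  one_mem : ∀ n, 1 ∈ U n
  inv_mem : ∀ n, ∀ g ∈ U n, g⁻¹ ∈ U n
  mul_mem : ∀ m n, m < n → ∀ a ∈ U n, ∀ b ∈ U n, ∀ c ∈ U n, a * b * c ∈ U m
  conj_mem : ∀ k g, ∃ m, ∀ u ∈ U m, g * u * g⁻¹ ∈ U k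

namespace IsNhdsOneSeq

variable {G : Type*} [Group G] {U : ℕ → Set G}

theorem mul_mem_of_lt (hU : IsNhdsOneSeq U) {m n : ℕ} (h : m < n) {a b : G} (ha : a ∈ U n)
    (hb : b ∈ U n) : a * b ∈ U m := by
  simpa using hU.mul_mem m n h a ha b hb 1 (hU.one_mem n)

theorem antitone (hU : IsNhdsOneSeq U) {m n : ℕ} (h : m ≤ n) : U n ⊆ U m := by
  rcases h.eq_or_lt with rfl | h
  · exact subset_rfl
  · intro a ha
    simpa using hU.mul_mem_of_lt h ha (hU.one_mem n)

theorem shift (hU : IsNhdsOneSeq U) : IsNhdsOneSeq fun n => U (n + 1) where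
  one_mem n := hU.one_mem _
  inv_mem n := hU.inv_mem _
  mul_mem m n h := hU.mul_mem _ _ (by omega)
  conj_mem k g := by
    obtain ⟨m, hm⟩ := hU.conj_mem (k + 1) g
    exact ⟨m, fun u hu => hm u (hU.antitone (Nat.le_succ m) hu)⟩

/-- The group of all sequences whose inner automorphisms are eventually equicontinuous at `1`,
for the topology with the base `U` at `1`. -/
def equicontinuousSeq (hU : IsNhdsOneSeq U) : Subgroup (ℕ → G) where
  carrier := {s | ∀ k, ∃ m, ∀ᶠ n in atTop, ∀ u ∈ U m,
    s n * u * (s n)⁻¹ ∈ U k ∧ (s n)⁻¹ * u * s n ∈ U k}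
  one_mem' k := ⟨k, Eventually.of_forall fun n u hu => by simpa using hu⟩
  inv_mem' {s} hs k := by
    obtain ⟨m, hm⟩ := hs k
    refine ⟨m, hm.mono fun n hn u hu => ?_⟩
    simpa [and_comm] using hn u hu
  mul_mem' {s t} hs ht k := by
    obtain ⟨m₁, h₁⟩ := hs k
    obtain ⟨m₂, h₂⟩ := ht m₁
    obtain ⟨l₁, h₃⟩ := ht k
    obtain ⟨l₂, h₄⟩ := hs l₁
    refine ⟨max m₂ l₂, ?_⟩
    filter_upwards [h₁, h₂, h₃, h₄] with n e₁ e₂ e₃ e₄ u hu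
    have a := (e₁ _ (e₂ u (hU.antitone (le_max_left _ _) hu)).1).1
    have b := (e₃ _ (e₄ u (hU.antitone (le_max_right _ _) hu)).2).2
    simp only [Pi.mul_apply, mul_inv_rev]
    refine ⟨?_, ?_⟩
    · convert a using 1; group
    · convert b using 1; group

/-- The group topology on `equicontinuousSeq` in which `s` is close to `1` if the terms of `s` are
eventually close to `1`. -/
@[reducible]
def seqBasis (hU : IsNhdsOneSeq U) : GroupFilterBasis hU.equicontinuousSeq where
  sets := range fun k => {s | ∀ᶠ n in atTop, s.1 n ∈ U k}
  nonempty := range_nonempty _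
  inter_sets := by
    rintro _ _ ⟨k, rfl⟩ ⟨l, rfl⟩
    refine ⟨_, ⟨max k l, rfl⟩, fun s hs => ⟨?_, ?_⟩⟩
    · exact hs.mono fun n hn => hU.antitone (le_max_left _ _) hn
    · exact hs.mono fun n hn => hU.antitone (le_max_right _ _) hn
  one' := by
    rintro _ ⟨k, rfl⟩
    exact Eventually.of_forall fun n => hU.one_mem k
  mul' := by
    rintro _ ⟨k, rfl⟩
    refine ⟨_, ⟨k + 1, rfl⟩, ?_⟩
    rintro _ ⟨s, hs, t, ht, rfl⟩
    filter_upwards [hs, ht] with n h₁ h₂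
    exact hU.mul_mem_of_lt (Nat.lt_succ_self k) h₁ h₂
  inv' := by
    rintro _ ⟨k, rfl⟩
    exact ⟨_, ⟨k, rfl⟩, fun s hs => Eventually.mono hs fun n hn => hU.inv_mem k _ hn⟩
  conj' := by
    rintro s _ ⟨k, rfl⟩
    obtain ⟨m, hm⟩ := s.2 k
    refine ⟨_, ⟨m, rfl⟩, fun t ht => ?_⟩
    filter_upwards [hm, ht] with n h₁ h₂
    exact (h₁ _ h₂).1

/-- The constant sequences. -/
def constSeq (hU : IsNhdsOneSeq U) : G →* hU.equicontinuousSeq where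
  toFun g := ⟨fun _ => g, fun k => by
    obtain ⟨m, hm⟩ := hU.conj_mem k g
    obtain ⟨l, hl⟩ := hU.conj_mem k g⁻¹
    refine ⟨max m l, Eventually.of_forall fun n u hu => ⟨hm u (hU.antitone (le_max_left _ _) hu), ?_⟩⟩
    simpa using hl u (hU.antitone (le_max_right _ _) hu)⟩
  map_one' := rfl
  map_mul' _ _ := rfl

/-- A sequence which is a Cauchy sequence on both sides for the topology with the base `U`. -/
structure IsFastCauchy (U : ℕ → Set G) (p : ℕ → G) : Prop where
  left_mem : ∀ n, (p n)⁻¹ * p (n + 1) ∈ U n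
  right_mem : ∀ n, p (n + 1) * (p n)⁻¹ ∈ U n

variable {p : ℕ → G}

theorem IsFastCauchy.exists_left (hU : IsNhdsOneSeq U) (hp : IsFastCauchy U p) {m n : ℕ}
    (h : m ≤ n) : ∃ a ∈ U m, ∃ b ∈ U m, (p m)⁻¹ * p n = a * b := by
  obtain ⟨d, rfl⟩ := Nat.exists_eq_add_of_le h
  clear h
  induction d generalizing m with
  | zero => exact ⟨1, hU.one_mem m, 1, hU.one_mem m, by simp⟩
  | succ d ih =>
    obtain ⟨a, ha, b, hb, e⟩ := ih (m := m + 1)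
    refine ⟨_, hp.left_mem m, a * b, hU.mul_mem_of_lt (Nat.lt_succ_self m) ha hb, ?_⟩
    rw [← e, show m + (d + 1) = m + 1 + d by omega]
    group

theorem IsFastCauchy.exists_right (hU : IsNhdsOneSeq U) (hp : IsFastCauchy U p) {m n : ℕ}
    (h : m ≤ n) : ∃ a ∈ U m, ∃ b ∈ U m, p n * (p m)⁻¹ = a * b := by
  obtain ⟨d, rfl⟩ := Nat.exists_eq_add_of_le h
  clear h
  induction d generalizing m with
  | zero => exact ⟨1, hU.one_mem m, 1, hU.one_mem m, by simp⟩
  | succ d ih =>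
    obtain ⟨a, ha, b, hb, e⟩ := ih (m := m + 1)
    refine ⟨a * b, hU.mul_mem_of_lt (Nat.lt_succ_self m) ha hb, _, hp.right_mem m, ?_⟩
    rw [← e, show m + (d + 1) = m + 1 + d by omega]
    group

/-- Up to a factor in `U (k + 1)`, conjugation by `p n` is conjugation by the fixed element `p (k +
2)`. The right Cauchy condition handles `p n`, the left one its inverse. -/
theorem IsFastCauchy.mem_equicontinuousSeq (hU : IsNhdsOneSeq U) (hp : IsFastCauchy U p) :
    p ∈ hU.equicontinuousSeq := by
  intro k
  obtain ⟨m, hm⟩ := hU.conj_mem (k + 1) (p (k + 2))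
  obtain ⟨l, hl⟩ := hU.conj_mem (k + 1) (p (k + 2))⁻¹
  refine ⟨max m l, (eventually_ge_atTop (k + 2)).mono fun n hn u hu => ?_⟩
  obtain ⟨a, ha, b, hb, e⟩ := hp.exists_right hU hn
  obtain ⟨c, hc, d, hd, e'⟩ := hp.exists_left hU hn
  have hab := hU.mul_mem_of_lt (Nat.lt_succ_self (k + 1)) ha hb
  have hcd := hU.mul_mem_of_lt (Nat.lt_succ_self (k + 1)) hc hd
  rw [← e] at hab
  rw [← e'] at hcd
  have h₁ := hm u (hU.antitone (le_max_left _ _) hu)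
  have h₂ := hl u (hU.antitone (le_max_right _ _) hu)
  have h₃ := hU.mul_mem k _ (Nat.lt_succ_self k) _ hab _ h₁ _ (hU.inv_mem _ _ hab)
  have h₄ := hU.mul_mem k _ (Nat.lt_succ_self k) _ (hU.inv_mem _ _ hcd) _ h₂ _ hcd
  constructor
  · convert h₃ using 1; group
  · convert h₄ using 1; group

end IsNhdsOneSeq

/-- A continuous homomorphism from a `c`-compact group attains limits of images of sequences which
are Cauchy for a coarser first countable group topology. -/
theorem IsCCompact.exists_map_eq_of_isFastCauchy.{u} {G : Type u} [Group G] [TopologicalSpace G]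
    [IsTopologicalGroup G] (hG : IsCCompact G) {K : Type u} [Group K] [TopologicalSpace K]
    [IsTopologicalGroup K] [T2Space K] (f : G →* K) (hf : Continuous f) {U : ℕ → Set G}
    (hU : IsNhdsOneSeq U) (hUn : ∀ n, U n ∈ 𝓝 1) {p : ℕ → G}
    (hp : IsNhdsOneSeq.IsFastCauchy U p) {z : K}
    (hz : ∀ n, (f (p n))⁻¹ * z ∈ closure (f '' U n)) :
    ∃ x, f x = z ∧ ∀ k, ∀ᶠ n in atTop, (p n)⁻¹ * x ∈ U k := by
  let _ : TopologicalSpace hU.equicontinuousSeq := hU.seqBasis.topology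
  have _ : IsTopologicalGroup hU.equicontinuousSeq := hU.seqBasis.isTopologicalGroup
  have hb : ∀ s : hU.equicontinuousSeq, ∀ O ∈ 𝓝 s, ∃ k, ∀ t : hU.equicontinuousSeq,
      (∀ᶠ n in atTop, (s.1 n)⁻¹ * t.1 n ∈ U k) → t ∈ O := by
    intro s O hO
    obtain ⟨_, ⟨k, rfl⟩, hk⟩ := (hU.seqBasis.nhds_hasBasis s).mem_iff.1 hO
    exact ⟨k, fun t ht => hk ⟨s⁻¹ * t, ht, by simp⟩⟩
  have hb' : ∀ s : hU.equicontinuousSeq, ∀ k,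
      {t : hU.equicontinuousSeq | ∀ᶠ n in atTop, (s.1 n)⁻¹ * t.1 n ∈ U k} ∈ 𝓝 s := by
    intro s k
    refine (hU.seqBasis.nhds_hasBasis s).mem_iff.2 ⟨_, ⟨k, rfl⟩, ?_⟩
    rintro _ ⟨t, ht, rfl⟩
    exact Eventually.mono ht fun n hn => by simpa using hn
  have hc : Continuous hU.constSeq := by
    refine continuous_of_continuousAt_one _ fun O hO => ?_
    rw [map_one] at hO
    obtain ⟨k, hk⟩ := hb 1 O hO
    refine mem_map.2 (mem_of_superset (hUn k) fun g hg => hk _ (Eventually.of_forall fun n => ?_))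
    simpa [IsNhdsOneSeq.constSeq] using hg
  have hpm := hp.mem_equicontinuousSeq hU
  -- The point `(p, z)` is approximated by images of `p (k + 1) * v` with `v ∈ U (k + 1)`: the
  -- constant sequence is eventually close to `p`, and `v` is chosen to bring the second coordinate
  -- close to `z`.
  obtain ⟨x, hx⟩ := hG.exists_inseparable (hU.constSeq.prod f) (hc.prodMk hf)
    (x := (⟨p, hpm⟩, z)) (by
      rw [mem_closure_iff_nhds]
      intro O hO
      obtain ⟨O₁, h₁, O₂, h₂, hO⟩ := mem_nhds_prod_iff.1 hO
      obtain ⟨k, hk⟩ := hb _ O₁ h₁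
      have h₃ : (fun w => f (p (k + 1)) * w) ⁻¹' O₂ ∈ 𝓝 ((f (p (k + 1)))⁻¹ * z) :=
        (continuous_const_mul _).continuousAt.preimage_mem_nhds (by simpa using h₂)
      obtain ⟨_, hv, v, hvU, rfl⟩ := mem_closure_iff_nhds.1 (hz (k + 1)) _ h₃
      refine ⟨_, hO ⟨hk (hU.constSeq (p (k + 1) * v)) ?_, ?_⟩, p (k + 1) * v, rfl⟩
      · refine (eventually_ge_atTop (k + 1)).mono fun n hn => ?_
        obtain ⟨a, ha, b, hb, e⟩ := hp.exists_left hU hn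
        convert hU.mul_mem k _ (Nat.lt_succ_self k) _ (hU.inv_mem _ _ hb) _ (hU.inv_mem _ _ ha) _
          hvU using 1
        rw [← mul_inv_rev, ← e]
        simp [IsNhdsOneSeq.constSeq, mul_assoc]
      · simpa using hv)
  refine ⟨x, (hx.map continuous_snd).eq, fun k => ?_⟩
  have h := hb' ⟨p, hpm⟩ k
  rw [← show 𝓝 (hU.constSeq x) = _ from (hx.map continuous_fst).nhds_eq] at h
  exact (mem_of_mem_nhds h : _ ∈ {t : hU.equicontinuousSeq | _})

theorem exists_seq_of_forall_exists_succ {α : Type*} (P : ℕ → α → Prop) (R : ℕ → α → α → Prop)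
    (h₀ : ∃ a, P 0 a) (hs : ∀ n a, P n a → ∃ b, P (n + 1) b ∧ R n a b) :
    ∃ s : ℕ → α, ∀ n, P n (s n) ∧ R n (s n) (s (n + 1)) := by
  choose! g hg using hs
  obtain ⟨a, ha⟩ := h₀
  let s : ℕ → α := fun n => Nat.rec a g n
  have hP : ∀ n, P n (s n) := fun n => by
    induction n with
    | zero => exact ha
    | succ n ih => exact (hg n _ ih).1
  exact ⟨s, fun n => ⟨hP n, (hg n _ (hP n)).2⟩⟩

/-! ### Narrow groups: countable bases and almost openness. -/

/-- A topological group is *`ω`-narrow* if it is covered by countably many translates of every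
neighbourhood of `1`. -/
def IsOmegaNarrow (G : Type*) [Group G] [TopologicalSpace G] : Prop :=
  ∀ U ∈ 𝓝 (1 : G), ∃ d : ℕ → G, ∀ g, ∃ l, g * (d l)⁻¹ ∈ U

section

variable {G : Type*} [Group G] [TopologicalSpace G] [IsTopologicalGroup G]

theorem exists_nhds_one_mul_mul_inv {V : Set G} (hV : V ∈ 𝓝 1) :
    ∃ W ∈ 𝓝 (1 : G), (∀ g ∈ W, g⁻¹ ∈ W) ∧ ∀ a ∈ W, ∀ b ∈ W, ∀ c ∈ W, a * b * c ∈ V := by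
  obtain ⟨W, hW, h⟩ := exists_nhds_one_split4 hV
  refine ⟨W ∩ W⁻¹, inter_mem hW (inv_mem_nhds_one G hW), fun g hg => ⟨hg.2, by simpa using hg.1⟩,
    fun a ha b hb c hc => ?_⟩
  simpa using h ha.1 hb.1 hc.1 (mem_of_mem_nhds hW)

theorem conj_preimage_mem_nhds_one (d : G) {V : Set G} (hV : V ∈ 𝓝 1) :
    {u | d * u * d⁻¹ ∈ V} ∈ 𝓝 (1 : G) :=
  (show Continuous fun u : G => d * u * d⁻¹ by fun_prop).continuousAt.preimage_mem_nhds
    (by simpa using hV)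

theorem IsOmegaNarrow.exists_isNhdsOneSeq (hG : IsOmegaNarrow G) {V : Set G} (hV : V ∈ 𝓝 1) :
    ∃ U : ℕ → Set G, IsNhdsOneSeq U ∧ (∀ n, U n ∈ 𝓝 1) ∧ U 0 ⊆ V := by
  choose! d hd using hG
  -- Diagonal choice: a pair is a neighbourhood and a bound `j`, and the new neighbourhood must
  -- behave under conjugation by the first `j` translates `d` attached to each earlier one. As `j`
  -- strictly increases, every translate is eventually handled.
  obtain ⟨F, hF, hr⟩ := exists_seq_of_forall_finset_exists
    (α := Set G × ℕ)
    (fun A => A.1 ∈ 𝓝 1 ∧ (∀ g ∈ A.1, g⁻¹ ∈ A.1) ∧ A.1 ⊆ V)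
    (fun A B => (∀ a ∈ B.1, ∀ b ∈ B.1, ∀ c ∈ B.1, a * b * c ∈ A.1) ∧ A.2 < B.2 ∧
      ∀ l < B.2, ∀ u ∈ B.1, d A.1 l * u * (d A.1 l)⁻¹ ∈ A.1) (by
    intro s hs
    let j := s.sup Prod.snd + 1
    have hO : V ∩ ⋂ A ∈ s, (A.1 ∩ ⋂ l ∈ Finset.range j, {u | d A.1 l * u * (d A.1 l)⁻¹ ∈ A.1})
        ∈ 𝓝 (1 : G) := by
      refine inter_mem hV ((biInter_finset_mem _).2 fun A hA => inter_mem (hs A hA).1 ?_)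
      exact (biInter_finset_mem _).2 fun l _ => conj_preimage_mem_nhds_one _ (hs A hA).1
    obtain ⟨W, hW, hinv, hmul⟩ := exists_nhds_one_mul_mul_inv hO
    have h1 := mem_of_mem_nhds hW
    have hsub : ∀ u ∈ W, u ∈ V ∩ ⋂ A ∈ s, (A.1 ∩ ⋂ l ∈ Finset.range j,
        {u | d A.1 l * u * (d A.1 l)⁻¹ ∈ A.1}) := fun u hu => by
      simpa using hmul u hu 1 h1 1 h1
    refine ⟨(W, j), ⟨hW, hinv, fun u hu => (hsub u hu).1⟩, fun A hA => ⟨?_, ?_, ?_⟩⟩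
    · exact fun a ha b hb c hc => (mem_iInter₂.1 (hmul a ha b hb c hc).2 A hA).1
    · exact Nat.lt_succ_of_le (Finset.le_sup (f := Prod.snd) hA)
    · exact fun l hl u hu =>
        mem_iInter₂.1 (mem_iInter₂.1 (hsub u hu).2 A hA).2 l (Finset.mem_range.2 hl))
  have hmono : StrictMono fun n => (F n).2 := fun m n h => (hr m n h).2.1
  refine ⟨fun n => (F n).1, ⟨fun n => mem_of_mem_nhds (hF n).1, fun n => (hF n).2.1,
    fun m n h => (hr m n h).1, fun k g => ?_⟩, fun n => (hF n).1, (hF 0).2.2⟩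
  obtain ⟨l, hl⟩ := hd (F (k + 1)).1 (hF (k + 1)).1 g
  have hlt : l < (F (l + k + 2)).2 := lt_of_lt_of_le (show l < l + k + 2 by omega) hmono.le_apply
  -- Here `g = w * d l` with `w` in the set of index `k + 1`; conjugate by `d l`, then by `w`.
  refine ⟨l + k + 2, fun u hu => ?_⟩
  have h := (hr (k + 1) (l + k + 2) (by omega)).2.2 l hlt u hu
  convert (hr k (k + 1) (Nat.lt_succ_self k)).1 _ hl _ h _ ((hF (k + 1)).2.1 _ hl) using 1
  group

/-- Countably many translates of `closure (f '' W)` cover `K`, so by Baire one has interior;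
quotients of its points lie in `closure (f '' V)`. -/
theorem IsOmegaNarrow.closure_image_mem_nhds (hG : IsOmegaNarrow G) {K : Type*} [Group K]
    [TopologicalSpace K] [IsTopologicalGroup K] [BaireSpace K] (f : G →* K)
    (hs : Function.Surjective f) {V : Set G} (hV : V ∈ 𝓝 1) : closure (f '' V) ∈ 𝓝 1 := by
  obtain ⟨W, hW, hinv, hmul⟩ := exists_nhds_one_mul_mul_inv hV
  obtain ⟨d, hd⟩ := hG W hW
  have hc : ∀ l, IsClosed {z | z * (f (d l))⁻¹ ∈ closure (f '' W)} := fun l =>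
    isClosed_closure.preimage (by fun_prop)
  have hU : ⋃ l, {z | z * (f (d l))⁻¹ ∈ closure (f '' W)} = univ := by
    refine eq_univ_of_forall fun z => ?_
    obtain ⟨g, rfl⟩ := hs z
    obtain ⟨l, hl⟩ := hd g
    exact mem_iUnion.2 ⟨l, subset_closure ⟨_, hl, by simp⟩⟩
  obtain ⟨l, z, hz⟩ := nonempty_interior_of_iUnion_of_closed hc hU
  have hz' := mem_interior_iff_mem_nhds.1 hz
  have : {w | w * z ∈ {z | z * (f (d l))⁻¹ ∈ closure (f '' W)}} ∈ 𝓝 (1 : K) :=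
    (continuous_mul_const z).continuousAt.preimage_mem_nhds (by simpa using hz')
  refine mem_of_superset this fun w hw => ?_
  have hz₀ := interior_subset hz
  rw [mem_ofPred_eq] at hz₀
  have hm := map_mem_closure₂ (f := fun a b : K => a * b⁻¹) (s := f '' W) (t := f '' W) (u := f '' V) (by
    simp only [Function.uncurry_def]; fun_prop) hw hz₀ (by
    intro w₁ h₁ w₂ h₂
    obtain ⟨a, ha, rfl⟩ := h₁
    obtain ⟨b, hb, rfl⟩ := h₂
    exact ⟨a * b⁻¹, by simpa using hmul a ha _ (hinv b hb) 1 (mem_of_mem_nhds hW), by simp⟩)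
  simpa [mul_assoc] using hm

end

/-! ### The open mapping theorem and compactness from an injection. -/

namespace IsCCompact

universe u

variable {G : Type u} [Group G] [TopologicalSpace G] [IsTopologicalGroup G]
  {K : Type u} [Group K] [TopologicalSpace K] [IsTopologicalGroup K]

/-- Keeping the approximations Cauchy on the right needs a `k` depending on the current `p`, so the
limit `z` cannot be prescribed. Two sequences are therefore run over the same shrinking open sets,
towards `z` and `y⁻¹ * z`; the quotient of the limits maps to `y`. -/
theorem interior_closure_image_subset [CompactSpace K] [T2Space K] (hG : IsCCompact G) (f : G →* K)
    (hf : Continuous f) {U : ℕ → Set G} (hU : IsNhdsOneSeq U) (hUn : ∀ n, U n ∈ 𝓝 1)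
    (hcl : ∀ n, closure (f '' U n) ∈ 𝓝 1) {y : K} (hy : y ∈ interior (closure (f '' U 0))) :
    ∃ a b, (∃ k ∈ U 0, ∃ l ∈ U 0, ∃ m ∈ U 0, a = k * l * m) ∧
      (∃ k ∈ U 0, ∃ l ∈ U 0, ∃ m ∈ U 0, b = k * l * m) ∧ f a = y * f b := by
  -- The next stage of an approximation from the coset `c`.
  have step : ∀ (c : K) (n : ℕ) (p : G) (k : ℕ) (B : Set K), IsOpen B → B.Nonempty → n ≤ k →
      (∀ u ∈ U k, p * u * p⁻¹ ∈ U n) → (∀ z ∈ B, (f p)⁻¹ * (c⁻¹ * z) ∈ closure (f '' U k)) →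
      ∃ p' k' B', IsOpen B' ∧ B'.Nonempty ∧ n + 1 ≤ k' ∧
        (∀ u ∈ U k', p' * u * p'⁻¹ ∈ U (n + 1)) ∧
        (∀ z ∈ B', (f p')⁻¹ * (c⁻¹ * z) ∈ closure (f '' U k')) ∧ B' ⊆ B ∧
        p⁻¹ * p' ∈ U n ∧ p' * p⁻¹ ∈ U n := by
    intro c n p k B hB hne hk hpk hz
    obtain ⟨z, hzB⟩ := hne
    obtain ⟨_, hu, u, huU, rfl⟩ := mem_closure_iff.1 (hz z hzB)
      ((fun w => c * f p * w) ⁻¹' B) (hB.preimage (by fun_prop)) (by simpa [mul_assoc] using hzB)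
    obtain ⟨m, hm⟩ := hU.conj_mem (n + 1) (p * u)
    -- The new index is known only after `p * u`, so `B` is cut down to the points it still
    -- approximates; `c * f (p * u)` remains.
    refine ⟨p * u, max m (n + 1),
      B ∩ (fun z => (f (p * u))⁻¹ * (c⁻¹ * z)) ⁻¹'
        interior (closure (f '' U (max m (n + 1)))), hB.inter (isOpen_interior.preimage
          (by fun_prop)), ⟨c * f (p * u), ?_, ?_⟩, le_max_right _ _, fun v hv =>
          hm v (hU.antitone (le_max_left _ _) hv), fun z hz => interior_subset hz.2,
          inter_subset_left, ?_, ?_⟩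
    · simpa [mul_assoc] using hu
    · simpa [mul_assoc] using mem_interior_iff_mem_nhds.2 (hcl _)
    · simpa using hU.antitone hk huU
    · exact hpk u huU
  obtain ⟨s, hs⟩ := exists_seq_of_forall_exists_succ (α := (G × G) × (ℕ × ℕ) × Set K)
    (fun n a => (n = 0 → a.1.1 = 1 ∧ a.1.2 = 1) ∧ IsOpen a.2.2 ∧ a.2.2.Nonempty ∧
      (n ≤ a.2.1.1 ∧ (∀ u ∈ U a.2.1.1, a.1.1 * u * a.1.1⁻¹ ∈ U n) ∧
        ∀ z ∈ a.2.2, (f a.1.1)⁻¹ * (1⁻¹ * z) ∈ closure (f '' U a.2.1.1)) ∧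
      (n ≤ a.2.1.2 ∧ (∀ u ∈ U a.2.1.2, a.1.2 * u * a.1.2⁻¹ ∈ U n) ∧
        ∀ z ∈ a.2.2, (f a.1.2)⁻¹ * (y⁻¹ * z) ∈ closure (f '' U a.2.1.2)))
    (fun n a b => b.2.2 ⊆ a.2.2 ∧ (a.1.1⁻¹ * b.1.1 ∈ U n ∧ b.1.1 * a.1.1⁻¹ ∈ U n) ∧
      (a.1.2⁻¹ * b.1.2 ∈ U n ∧ b.1.2 * a.1.2⁻¹ ∈ U n)) (by
    have hO : IsOpen (interior (closure (f '' U 0)) ∩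
        (fun z => y⁻¹ * z) ⁻¹' interior (closure (f '' U 0))) :=
      isOpen_interior.inter (isOpen_interior.preimage (by fun_prop))
    refine ⟨((1, 1), (0, 0), _), fun _ => ⟨rfl, rfl⟩, hO, ⟨y, hy, ?_⟩, ⟨le_rfl, by simp, fun z hz => ?_⟩,
      le_rfl, by simp, fun z hz => ?_⟩
    · simpa using mem_interior_iff_mem_nhds.2 (hcl 0)
    · simpa using interior_subset hz.1
    · simpa using interior_subset hz.2) (by
    rintro n ⟨⟨p, q⟩, ⟨k, l⟩, B⟩ ⟨-, hB, hne, ⟨hk, hp, hz⟩, hl, hq, hz'⟩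
    obtain ⟨p', k', B', hB', hne', hk', hp', hw, hBB', h₁, h₂⟩ := step 1 n p k B hB hne hk hp hz
    obtain ⟨q', l', B'', hB'', hne'', hl', hq', hw', hBB'', h₃, h₄⟩ :=
      step y n q l B' hB' hne' hl hq fun z hz => hz' z (hBB' hz)
    exact ⟨((p', q'), (k', l'), B''), ⟨fun h => absurd h n.succ_ne_zero, hB'', hne'', ⟨hk', hp', fun z hz => hw z (hBB'' hz)⟩,
      hl', hq', hw'⟩, hBB''.trans hBB', ⟨h₁, h₂⟩, h₃, h₄⟩)
  obtain ⟨z, hz⟩ := IsCompact.nonempty_iInter_of_sequence_nonempty_isCompact_isClosed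
    (fun n => closure (s n).2.2) (fun n => closure_mono (hs n).2.1)
    (fun n => (hs n).1.2.2.1.closure) isClosed_closure.isCompact fun n => isClosed_closure
  rw [mem_iInter] at hz
  have limit : ∀ (c : K) (p : ℕ → G) (k : ℕ → ℕ), IsNhdsOneSeq.IsFastCauchy U p →
      (∀ n, n ≤ k n) →
      (∀ n, ∀ w ∈ (s n).2.2, (f (p n))⁻¹ * (c⁻¹ * w) ∈ closure (f '' U (k n))) →
      ∃ x, f x = c⁻¹ * z ∧ ∀ k, ∀ᶠ n in atTop, (p n)⁻¹ * x ∈ U k := by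
    intro c p k hp hk hw
    refine hG.exists_map_eq_of_isFastCauchy f hf hU hUn hp fun n => ?_
    refine closure_mono (image_mono (hU.antitone (hk n))) ?_
    exact closure_minimal (t := {w | (f (p n))⁻¹ * (c⁻¹ * w) ∈ closure (f '' U (k n))})
      (fun w hwB => hw n w hwB) (isClosed_closure.preimage (by fun_prop)) (hz n)
  have small : ∀ (p : ℕ → G) (x : G), IsNhdsOneSeq.IsFastCauchy U p → p 0 = 1 →
      (∀ k, ∀ᶠ n in atTop, (p n)⁻¹ * x ∈ U k) →
      ∃ k ∈ U 0, ∃ l ∈ U 0, ∃ m ∈ U 0, x = k * l * m := by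
    intro p x hp h0 hx
    obtain ⟨n, hn⟩ := (hx 0).exists
    obtain ⟨k, hk, l, hl, e⟩ := hp.exists_left hU (Nat.zero_le n)
    refine ⟨k, hk, l, hl, _, hn, ?_⟩
    rw [← e, h0]
    group
  have hp : IsNhdsOneSeq.IsFastCauchy U fun n => (s n).1.1 :=
    ⟨fun n => (hs n).2.2.1.1, fun n => (hs n).2.2.1.2⟩
  have hq : IsNhdsOneSeq.IsFastCauchy U fun n => (s n).1.2 :=
    ⟨fun n => (hs n).2.2.2.1, fun n => (hs n).2.2.2.2⟩
  obtain ⟨a, ha, ha'⟩ := limit 1 _ (fun n => (s n).2.1.1) hp (fun n => (hs n).1.2.2.2.1.1)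
    fun n => (hs n).1.2.2.2.1.2.2
  obtain ⟨b, hb, hb'⟩ := limit y _ (fun n => (s n).2.1.2) hq (fun n => (hs n).1.2.2.2.2.1)
    fun n => (hs n).1.2.2.2.2.2.2
  exact ⟨a, b, small _ a hp ((hs 0).1.1 rfl).1 ha', small _ b hq ((hs 0).1.1 rfl).2 hb',
    by simp [ha, hb]⟩

/-- The open mapping theorem for `ω`-narrow `c`-compact groups. -/
theorem isOpenMap_of_isOmegaNarrow [CompactSpace K] [T2Space K] (hG : IsCCompact G)
    (hn : IsOmegaNarrow G) (f : G →* K) (hf : Continuous f) (hs : Function.Surjective f) :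
    IsOpenMap f := by
  refine IsTopologicalGroup.isOpenMap_iff_nhds_one.2 fun T hT => ?_
  obtain ⟨U, hU, hUn, hU0⟩ := hn.exists_isNhdsOneSeq (mem_map.1 hT)
  have hcl : ∀ n, closure (f '' U n) ∈ 𝓝 1 := fun n => hn.closure_image_mem_nhds f hs (hUn n)
  -- Starting at `U 2` leaves room: `a` and `b` are triple products, hence in `U 1`, and `a * b⁻¹ ∈
  -- U 0`.
  refine mem_of_superset (interior_mem_nhds.2 (hcl 2)) fun y hy => ?_
  obtain ⟨a, b, ⟨k, hk, l, hl, m, hm, rfl⟩, ⟨k', hk', l', hl', m', hm', rfl⟩, e⟩ :=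
    hG.interior_closure_image_subset f hf hU.shift.shift (fun n => hUn _) (fun n => hcl _) hy
  have ha := hU.mul_mem 1 2 one_lt_two _ hk _ hl _ hm
  have hb := hU.mul_mem 1 2 one_lt_two _ hk' _ hl' _ hm'
  have := hU0 (hU.mul_mem_of_lt zero_lt_one ha (hU.inv_mem _ _ hb))
  rw [mem_preimage, map_mul, map_inv, e, mul_inv_cancel_right] at this
  exact this

theorem compactSpace_of_isOmegaNarrow [CompactSpace K] [T2Space K] (hG : IsCCompact G)
    (hn : IsOmegaNarrow G) (f : G →* K) (hf : Continuous f) (hi : Function.Injective f) :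
    CompactSpace G := by
  have : CompactSpace f.range :=
    isCompact_iff_compactSpace.1 (by simpa using (hG.isClosed_range f hf).isCompact)
  have hc : Continuous f.rangeRestrict := hf.subtype_mk _
  have ho := hG.isOpenMap_of_isOmegaNarrow hn f.rangeRestrict hc f.rangeRestrict_surjective
  exact ((Equiv.ofBijective f.rangeRestrict ⟨f.rangeRestrict_injective_iff.2 hi,
    f.rangeRestrict_surjective⟩).toHomeomorphOfContinuousOpen hc ho).symm.compactSpace

/-- If `G` were not `ω`-narrow, it would contain a uniformly discrete sequence. The closed subgroup
generated by that sequence is `ω`-narrow, hence compact, and a cluster point there gives a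
contradiction. -/
theorem compactSpace_of_injective [CompactSpace K] [T2Space K] (hG : IsCCompact G)
    (f : G →* K) (hf : Continuous f) (hi : Function.Injective f) : CompactSpace G := by
  refine hG.compactSpace_of_isOmegaNarrow (fun U hU => ?_) f hf hi
  by_contra! h
  obtain ⟨x, -, hx⟩ := exists_seq_of_forall_finset_exists (fun _ : G => True)
    (fun a b => b * a⁻¹ ∉ U) (fun s _ => by
      by_contra! hc
      obtain ⟨e, he⟩ : ∃ e : ℕ → G, insert 1 (s : Set G) = range e :=
        -- Inserting `1` only makes the set nonempty, so that it can be enumerated.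
        (s.countable_toSet.insert 1).exists_eq_range (insert_nonempty _ _)
      obtain ⟨g, hg⟩ := h e
      obtain ⟨a, ha, ha'⟩ := hc g trivial
      obtain ⟨l, rfl⟩ : a ∈ range e := he ▸ mem_insert_of_mem 1 ha
      exact hg l ha')
  obtain ⟨W, hW, hinv, hmul⟩ := exists_nhds_one_mul_mul_inv hU
  let D := (FreeGroup.lift x).range
  let M := D.topologicalClosure
  have hM : IsClosed (M : Set G) := D.isClosed_topologicalClosure
  have hD : (D : Set G).Countable := by
    have : Countable (FreeGroup ℕ) := inferInstanceAs (Countable (Quot _))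
    rw [MonoidHom.coe_range]
    exact countable_range _
  have hMn : IsOmegaNarrow M := by
    intro V hV
    obtain ⟨O, hO, hOV⟩ := mem_nhds_subtype _ _ _ |>.1 hV
    obtain ⟨e, he⟩ := hD.exists_eq_range ⟨1, D.one_mem⟩
    have heD : ∀ l, e l ∈ M := fun l => D.le_topologicalClosure
      (show e l ∈ (D : Set G) from he ▸ mem_range_self l)
    refine ⟨fun l => ⟨e l, heD l⟩, fun g => ?_⟩
    have hg : (g : G) ∈ closure (D : Set G) := g.2
    have hN : {d : G | g.1 * d⁻¹ ∈ O} ∈ 𝓝 g.1 :=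
      (show Continuous fun d : G => g.1 * d⁻¹ by fun_prop).continuousAt.preimage_mem_nhds
        (by simpa using hO)
    obtain ⟨d, hd, hdD⟩ := mem_closure_iff_nhds.1 hg _ hN
    rw [he] at hdD
    obtain ⟨l, rfl⟩ := hdD
    exact ⟨l, hOV hd⟩
  have hMc := (hG.subgroup M hM).compactSpace_of_isOmegaNarrow hMn (f.comp M.subtype)
    (hf.comp continuous_subtype_val) (hi.comp Subtype.val_injective)
  have hMc' : IsCompact (M : Set G) := isCompact_iff_compactSpace.2 hMc
  have hxM : ∀ n, x n ∈ M := fun n =>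
    D.le_topologicalClosure ⟨FreeGroup.of n, by simp⟩
  obtain ⟨a, -, ha⟩ := hMc'.exists_mapClusterPt (f := atTop) (u := x)
    (tendsto_principal.2 (Eventually.of_forall hxM))
  have hN : {d : G | d * a⁻¹ ∈ W} ∈ 𝓝 a :=
    (show Continuous fun d : G => d * a⁻¹ by fun_prop).continuousAt.preimage_mem_nhds
      (by simpa using hW)
  have hfr := ha.frequently hN
  obtain ⟨m, -, hm⟩ := frequently_atTop.1 hfr 0
  obtain ⟨n, hmn, hn⟩ := frequently_atTop.1 hfr (m + 1)
  refine hx m n hmn ?_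
  simpa using hmul _ hn _ (hinv _ hm) 1 (mem_of_mem_nhds hW)

end IsCCompact

/-! ### Compactness of unitary groups and of extensions. -/

theorem compactSpace_unitaryGroup (n : ℕ) : CompactSpace (Matrix.unitaryGroup (Fin n) ℂ) := by
  refine isCompact_iff_compactSpace.1 (IsCompact.of_isClosed_subset
    (isCompact_univ_pi fun _ : Fin n => isCompact_univ_pi fun _ : Fin n =>
      isCompact_closedBall (0 : ℂ) 1) (isClosed_unitary (R := Matrix (Fin n) (Fin n) ℂ)) ?_)
  intro A hA i _ j _
  simpa using entry_norm_bound_of_unitary hA i j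

/-- Compactness passes to extensions: if `G ⧸ M` and the image of `M` in `G ⧸ N` are compact,
then so is `G ⧸ N`. -/
theorem QuotientGroup.compactSpace_of_isCompact_map {G : Type*} [Group G] [TopologicalSpace G]
    [IsTopologicalGroup G] (N M : Subgroup G) [N.Normal] [M.Normal]
    (hM : IsCompact ((M.map (QuotientGroup.mk' N) : Subgroup (G ⧸ N)) : Set (G ⧸ N)))
    [CompactSpace (G ⧸ M)] : CompactSpace (G ⧸ N) := by
  set B := M.map (QuotientGroup.mk' N) with hB
  have : B.Normal := ‹M.Normal›.map _ (QuotientGroup.mk'_surjective N)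
  let g : G →* (G ⧸ N) ⧸ B := (QuotientGroup.mk' B).comp (QuotientGroup.mk' N)
  have hg : Continuous g := QuotientGroup.continuous_mk.comp QuotientGroup.continuous_mk
  have hgM : M ≤ g.ker := fun m hm => by
    rw [MonoidHom.mem_ker]
    exact (QuotientGroup.eq_one_iff _).2 (Subgroup.mem_map_of_mem _ hm)
  have hgs : Function.Surjective g :=
    (QuotientGroup.mk'_surjective B).comp (QuotientGroup.mk'_surjective N)
  have hlift : Continuous (QuotientGroup.lift M g hgM) := hg.quotient_lift _
  have hlifts : Function.Surjective (QuotientGroup.lift M g hgM) := fun y => by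
    obtain ⟨x, rfl⟩ := hgs y
    exact ⟨(x : G ⧸ M), rfl⟩
  have : CompactSpace ((G ⧸ N) ⧸ B) := hlifts.compactSpace hlift
  -- Dividing by a compact subgroup is proper: it is closed, and its fibres are translates of `B`.
  have hp : IsProperMap ((↑) : G ⧸ N → (G ⧸ N) ⧸ B) := by
    refine isProperMap_iff_isClosedMap_and_compact_fibers.2
      ⟨QuotientGroup.continuous_mk, QuotientGroup.isClosedMap_coe hM, fun y => ?_⟩
    obtain ⟨q, rfl⟩ := QuotientGroup.mk_surjective y
    convert hM.image (continuous_const_mul q) using 1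
    ext r
    simp only [mem_preimage, mem_singleton_iff, eq_comm (a := (r : (G ⧸ N) ⧸ B)), QuotientGroup.eq]
    exact ⟨fun h => ⟨_, h, by simp⟩, by rintro ⟨b, hb, rfl⟩; simpa using hb⟩
  exact isCompact_univ_iff.1 (by simpa using hp.isCompact_preimage isCompact_univ)

/-! ### The maximal compact quotient and its kernel. -/

namespace IsCCompact

universe u

variable {G : Type u} [Group G] [TopologicalSpace G] [IsTopologicalGroup G]

theorem compactSpace_quotient_ker (hG : IsCCompact G) {K : Type u} [Group K] [TopologicalSpace K]
    [IsTopologicalGroup K] [CompactSpace K] [T2Space K] (f : G →* K) (hf : Continuous f) :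
    CompactSpace (G ⧸ f.ker) :=
  (hG.of_surjective (QuotientGroup.mk' f.ker) QuotientGroup.continuous_mk
    (QuotientGroup.mk'_surjective _)).compactSpace_of_injective (QuotientGroup.kerLift f)
    (hf.quotient_lift _) (QuotientGroup.kerLift_injective f)

theorem exists_isMaximalCompactQuotient (hG : IsCCompact G) :
    ∃ M : Subgroup G, IsMaximalCompactQuotient M := by
  let I := {N : Subgroup G // N.Normal ∧ IsClosed (N : Set G) ∧ CompactSpace (G ⧸ N)}
  have h₁ (N : I) : N.1.Normal := N.2.1
  have h₂ (N : I) : IsClosed (N.1 : Set G) := N.2.2.1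
  have h₃ (N : I) : CompactSpace (G ⧸ N.1) := N.2.2.2
  let f : G →* (∀ N : I, G ⧸ N.1) := MonoidHom.pi fun N : I => QuotientGroup.mk' N.1
  have hf : Continuous f := continuous_pi fun N => QuotientGroup.continuous_mk
  refine ⟨f.ker, inferInstance, isClosed_singleton.preimage hf, hG.compactSpace_quotient_ker f hf,
    fun N hN hNc hNq g hg => ?_⟩
  exact (QuotientGroup.eq_one_iff g).1 (congrFun hg ⟨N, hN, hNc, hNq⟩)

end IsCCompact

namespace IsMaximalCompactQuotient

universe u

variable {G : Type u} [Group G] [TopologicalSpace G] [IsTopologicalGroup G] {M : Subgroup G}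

theorem le_ker (hM : IsMaximalCompactQuotient M) (hG : IsCCompact G) {K : Type u} [Group K]
    [TopologicalSpace K] [IsTopologicalGroup K] [CompactSpace K] [T2Space K] (f : G →* K)
    (hf : Continuous f) : M ≤ f.ker :=
  hM.maximal _ inferInstance (isClosed_singleton.preimage hf) (hG.compactSpace_quotient_ker f hf)

theorem le_comap (hM : IsMaximalCompactQuotient M) (hG : IsCCompact G) (φ : G →* G)
    (hφ : Continuous φ) : M ≤ M.comap φ := by
  have := hM.normal
  have := hM.isClosed
  have := hM.compact
  intro g hg
  exact (QuotientGroup.eq_one_iff (φ g)).1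
    (hM.le_ker hG ((QuotientGroup.mk' M).comp φ) (QuotientGroup.continuous_mk.comp hφ) hg)

theorem isTopologicallyCharacteristic (hM : IsMaximalCompactQuotient M) (hG : IsCCompact G) :
    IsTopologicallyCharacteristic M := by
  intro φ
  refine le_antisymm (Subgroup.map_le_iff_le_comap.2 (hM.le_comap hG _ φ.continuous)) fun g hg => ?_
  exact ⟨φ.symm g, hM.le_comap hG (φ.symm : G ≃* G).toMonoidHom φ.symm.continuous hg,
    φ.apply_symm_apply g⟩

theorem isMinimallyAlmostPeriodic (hM : IsMaximalCompactQuotient M) (hG : IsCCompact G) :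
    IsMinimallyAlmostPeriodic M := by
  have hMn := hM.normal
  have hMc := hM.compact
  have hMC := hG.subgroup M hM.isClosed
  obtain ⟨L, hL⟩ := hMC.exists_isMaximalCompactQuotient
  have hLn := hL.normal
  have hLc := hL.compact
  let N := L.map M.subtype
  -- Conjugation by `g` is a continuous endomorphism of `M`, so it preserves `L`.
  have hN : N.Normal := by
    refine ⟨?_⟩
    rintro _ ⟨l, hl, rfl⟩ g
    let c : M →* M := (MulAut.conjNormal g : M ≃* M).toMonoidHom
    have hc : Continuous c := by
      refine Continuous.subtype_mk (f := fun m : M => g * m * g⁻¹) (by fun_prop) _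
    exact ⟨c l, hL.le_comap hMC c hc hl, rfl⟩
  have hNc : IsClosed (N : Set G) :=
    hM.isClosed.isClosedEmbedding_subtypeVal.isClosedMap _ hL.isClosed
  have hcomp : IsCompact ((M.map (QuotientGroup.mk' N) : Subgroup (G ⧸ N)) : Set (G ⧸ N)) := by
    let g : M →* G ⧸ N := (QuotientGroup.mk' N).comp M.subtype
    have hg : Continuous g := QuotientGroup.continuous_mk.comp continuous_subtype_val
    have hLg : L ≤ g.ker := fun l hl => (QuotientGroup.eq_one_iff _).2 ⟨l, hl, rfl⟩
    have hl : Continuous (QuotientGroup.lift L g hLg) := hg.quotient_lift _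
    convert isCompact_range hl using 1
    ext q
    constructor
    · rintro ⟨m, hm, rfl⟩
      exact ⟨((⟨m, hm⟩ : M) : M ⧸ L), rfl⟩
    · rintro ⟨m, rfl⟩
      obtain ⟨m, rfl⟩ := QuotientGroup.mk_surjective m
      exact ⟨m, m.2, rfl⟩
  have hMN : M ≤ N :=
    hM.maximal N hN hNc (QuotientGroup.compactSpace_of_isCompact_map N M hcomp)
  intro n ρ hρ g
  have hgL : g ∈ L := by
    obtain ⟨l, hl, e⟩ := hMN g.2
    rwa [← Subtype.ext e]
  have := compactSpace_unitaryGroup n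
  -- `ULift` moves the unitary group to the universe of `G`, where `le_ker` applies.
  have hu := hL.le_ker hMC (MulEquiv.ulift.symm.toMonoidHom.comp ρ :
    M →* ULift.{u} (Matrix.unitaryGroup (Fin n) ℂ)) (continuous_uliftUp.comp hρ) hgL
  exact congrArg ULift.down hu

end IsMaximalCompactQuotient

theorem mainTheorem6 (G : Type*) [Group G] [TopologicalSpace G] [IsTopologicalGroup G]
    [T2Space G] (hG : IsCCompact G) :
    ∃ M : Subgroup G,
      IsMaximalCompactQuotient M ∧ IsClosed (M : Set G) ∧ IsTopologicallyCharacteristic M ∧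
        IsMinimallyAlmostPeriodic M := by
  obtain ⟨M, hM⟩ := hG.exists_isMaximalCompactQuotient
  exact ⟨M, hM, hM.isClosed, hM.isTopologicallyCharacteristic hG, hM.isMinimallyAlmostPeriodic hG⟩
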